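/- All graphs are finite and simple. The algebraic connectivity $a(G)$ of a graph $G$ is the second smallest eigenvalue, counted with multiplicity, of its Laplacian matrix $L(G)=D(G)-A(G)$. For $n\ge 6$ let $H_{2n}$ be the bipartite graph on the $2n$ vertices $u_1,\dots,u_n,v_1,\dots,v_n$, with parts $\{u_1,\dots,u_n\}$ and $\{v_1,\dots,v_n\}$, whose edges are exactly the following: - $u_iv_{i+1}$ and $u_{i+1}v_i$ for $1\le i\le n-1$; - $u_iv_i$ for $1\le i\le n$ with $i\ne 3$ and $i\neq n-2$; - $u_1v_3$, $u_3v_1$, $u_{n-2}v_n$ and $u_nv_{n-2}$. **Theorem.** For every $n\geq 6$, the graph $H_{2n}$ is a connected cubic bipartite graph and, up to isomorphism, it is the unique graph with minimum algebraic connectivity among all connected cubic bipartite graphs on $2n$ vertices. That is, every connected cubic bipartite graph $G$ on $2n$ vertices satisfies $a(G)\ge a(H_{2n})$, with equality if and only if $G$ is isomorphic to $H_{2n}$. -/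

import Mathlib

/-- The algebraic connectivity of a finite graph: its second smallest Laplacian eigenvalue,
counted with multiplicity. Mathlib lists the eigenvalues of a Hermitian matrix in decreasing order
with indices `0, …, |V| - 1`, so the second smallest one has index `|V| - 2`.
(For graphs with fewer than two vertices there is no such eigenvalue; the value is then `0`.) -/
noncomputable def algebraicConnectivity {V : Type*} [Fintype V] [DecidableEq V]
    (G : SimpleGraph V) [DecidableRel G.Adj] : ℝ :=
  if h : 2 ≤ Fintype.card V then
    (G.isHermitian_lapMatrix (R := ℝ)).eigenvalues₀ ⟨Fintype.card V - 2, by omega⟩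
  else 0

/-- The relation `u_i ∼ v_j` of the graph `H_{2n}`, for indices `1 ≤ i, j ≤ n`:
the edges `u_i v_{i+1}` and `u_{i+1} v_i`, the edges `u_i v_i` with `i ≠ 3` and `i ≠ n - 2`,
and the four edges `u_1 v_3`, `u_3 v_1`, `u_{n-2} v_n`, `u_n v_{n-2}`. -/
def HLink (n i j : ℕ) : Prop :=
  j = i + 1 ∨ i = j + 1 ∨ (i = j ∧ i ≠ 3 ∧ i + 2 ≠ n) ∨
    (i = 1 ∧ j = 3) ∨ (i = 3 ∧ j = 1) ∨ (i + 2 = n ∧ j = n) ∨ (i = n ∧ j + 2 = n)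

instance (n i j : ℕ) : Decidable (HLink n i j) := by
  unfold HLink; infer_instance

/-- Adjacency in `H_{2n}`. The vertex `u_i` is `Sum.inl` and `v_j` is `Sum.inr` of the
corresponding element of `Fin n`, whose values start at `0`, hence the shift by one. -/
def HAdj (n : ℕ) : Fin n ⊕ Fin n → Fin n ⊕ Fin n → Prop
  | Sum.inl i, Sum.inr j => HLink n (i.val + 1) (j.val + 1)
  | Sum.inr j, Sum.inl i => HLink n (i.val + 1) (j.val + 1)
  | Sum.inl _, Sum.inl _ => False
  | Sum.inr _, Sum.inr _ => False

instance (n : ℕ) : DecidableRel (HAdj n)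
  | Sum.inl i, Sum.inr j => inferInstanceAs (Decidable (HLink n (i.val + 1) (j.val + 1)))
  | Sum.inr j, Sum.inl i => inferInstanceAs (Decidable (HLink n (i.val + 1) (j.val + 1)))
  | Sum.inl _, Sum.inl _ => inferInstanceAs (Decidable False)
  | Sum.inr _, Sum.inr _ => inferInstanceAs (Decidable False)

/-- The path-like graph `H_{2n}` on the `2n` vertices `u_1, …, u_n, v_1, …, v_n`. -/
def HGraph (n : ℕ) : SimpleGraph (Fin n ⊕ Fin n) where
  Adj := HAdj n
  symm := ⟨by rintro (a | a) (b | b) h <;> exact h⟩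
  loopless := ⟨by rintro (a | a) h <;> exact h⟩

instance (n : ℕ) : DecidableRel (HGraph n).Adj :=
  inferInstanceAs (DecidableRel (HAdj n))

/-! Take a Fiedler vector `f` of a connected cubic bipartite graph `G` and list each part in
increasing order of `f`, giving sequences `x` and `y`. By cubicity, the Laplacian energy is `3 * (f
⬝ᵥ f)` minus twice the sum of `x i * y j` over edges (`IsSumBipartite.energy_eq`). Summation by
parts in both indices turns the difference of two such edge sums into increments of `x` and `y`
weighted by differences of the counts `relBlock` of edges in initial boxes.

The path-like graph has the largest count in every initial box (`relBlock_le_pathLink`): edges leave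
such a box only where regularity, the size of a box, or connectedness forces them to. As all
increments are nonnegative, moving `f` to `HGraph n` does not raise the energy, and the variational
principle gives the inequality.

In case of equality `f` is also a sorted eigenvector of `HGraph n`. Its eigenvalue equations force
strict growth away from the two ends (`IsSortedPathEigenpair.lt_succ`), so the box counts agree for
both indices in `[2, n - 2]`. These counts determine the graph (`pathLink_of_relBlock_eq`). -/

/-! ### Variational characterization of the algebraic connectivity. -/

open Matrix in
/-- An orthonormal eigenbasis of a real symmetric matrix, listed in the order of `eigenvalues₀`. -/
theorem exists_orthonormal_eigenvalues₀ {V : Type*} [Fintype V] [DecidableEq V]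
    {A : Matrix V V ℝ} (hA : A.IsHermitian) :
    ∃ b : Fin (Fintype.card V) → V → ℝ,
      (∀ k, A *ᵥ b k = hA.eigenvalues₀ k • b k) ∧
      (∀ k l, b k ⬝ᵥ b l = if k = l then 1 else 0) ∧
      (∀ f g : V → ℝ, f ⬝ᵥ g = ∑ k, (f ⬝ᵥ b k) * (g ⬝ᵥ b k)) := by
  set e : Fin (Fintype.card V) ≃ V := Fintype.equivOfCardEq (Fintype.card_fin _) with he
  refine ⟨fun k => (hA.eigenvectorBasis (e k)).ofLp, fun k => ?_, fun k l => ?_, fun f g => ?_⟩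
  · have := hA.mulVec_eigenvectorBasis (e k)
    simpa [Matrix.IsHermitian.eigenvalues, ← he] using this
  · have := hA.eigenvectorBasis.orthonormal
    rw [orthonormal_iff_ite] at this
    have h2 := this (e l) (e k)
    rw [EuclideanSpace.inner_eq_star_dotProduct] at h2
    simpa [eq_comm] using h2
  · have h := hA.eigenvectorBasis.sum_inner_mul_inner (WithLp.toLp 2 f) (WithLp.toLp 2 g)
    simp only [EuclideanSpace.inner_eq_star_dotProduct, star_trivial] at h
    rw [dotProduct_comm f g, ← h, ← e.sum_comp]
    refine Finset.sum_congr rfl fun k _ => ?_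
    rw [dotProduct_comm f]

open Matrix in
theorem dotProduct_mulVec_eq_sum_of_eigenbasis {V κ : Type*} [Fintype V] [Fintype κ]
    {A : Matrix V V ℝ} (hA : A.IsSymm) {b : κ → V → ℝ} {μ : κ → ℝ}
    (hb : ∀ k, A *ᵥ b k = μ k • b k)
    (hp : ∀ f g : V → ℝ, f ⬝ᵥ g = ∑ k, (f ⬝ᵥ b k) * (g ⬝ᵥ b k)) (f : V → ℝ) :
    f ⬝ᵥ A *ᵥ f = ∑ k, μ k * (f ⬝ᵥ b k) ^ 2 := by
  rw [hp]
  refine Finset.sum_congr rfl fun k _ => ?_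
  have : (A *ᵥ f) ⬝ᵥ b k = μ k * (f ⬝ᵥ b k) := by
    rw [dotProduct_comm, dotProduct_mulVec, ← mulVec_transpose, hA.eq, hb, smul_dotProduct,
      smul_eq_mul, dotProduct_comm]
  rw [this]; ring

namespace SimpleGraph

variable {V : Type*} [Fintype V] [DecidableEq V] (G : SimpleGraph V) [DecidableRel G.Adj]

open Matrix

theorem lapMatrix_energy_nonneg (f : V → ℝ) : 0 ≤ f ⬝ᵥ G.lapMatrix ℝ *ᵥ f := by
  simpa using (G.posSemidef_lapMatrix (R := ℝ)).dotProduct_mulVec_nonneg f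

theorem lapMatrix_mulVec_dotProduct (f g : V → ℝ) :
    (G.lapMatrix ℝ *ᵥ f) ⬝ᵥ g = f ⬝ᵥ G.lapMatrix ℝ *ᵥ g := by
  rw [dotProduct_mulVec, ← mulVec_transpose, (G.isSymm_lapMatrix (R := ℝ)).eq]

/-- The variational lower bound for the energy of functions with zero sum. -/
theorem algebraicConnectivity_mul_le (hV : 2 ≤ Fintype.card V) (f : V → ℝ) (hf : ∑ v, f v = 0) :
    algebraicConnectivity G * (f ⬝ᵥ f) ≤ f ⬝ᵥ G.lapMatrix ℝ *ᵥ f := by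
  rw [algebraicConnectivity, dif_pos hV]
  set hA := G.isHermitian_lapMatrix (R := ℝ)
  set i : Fin (Fintype.card V) := ⟨Fintype.card V - 2, by omega⟩ with hi
  set j : Fin (Fintype.card V) := ⟨Fintype.card V - 1, by omega⟩ with hj
  obtain ⟨b, hb, ho, hp⟩ := exists_orthonormal_eigenvalues₀ hA
  have hs := dotProduct_mulVec_eq_sum_of_eigenbasis (G.isSymm_lapMatrix (R := ℝ)) hb hp
  -- If the second smallest eigenvalue is positive, every `b k` with `k ≠ j` is orthogonal to the
  -- constants. Hence `f`, having zero sum, has no component along `b j`.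
  rcases le_or_gt (hA.eigenvalues₀ i) 0 with h0 | h0
  · have hn : 0 ≤ f ⬝ᵥ f := by simpa using dotProduct_star_self_nonneg f
    exact (mul_nonpos_of_nonpos_of_nonneg h0 hn).trans (G.lapMatrix_energy_nonneg f)
  have hle : ∀ k, k ≠ j → hA.eigenvalues₀ i ≤ hA.eigenvalues₀ k := by
    intro k hk
    refine hA.eigenvalues₀_antitone ?_
    rw [Fin.le_def]
    have : k.val ≠ j.val := fun h => hk (Fin.ext h)
    have := k.2
    simp only [hi, hj] at *
    omega
  set u : V → ℝ := fun _ => 1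
  have hu : G.lapMatrix ℝ *ᵥ u = 0 := G.lapMatrix_mulVec_const_eq_zero
  have horth : ∀ k, k ≠ j → u ⬝ᵥ b k = 0 := by
    intro k hk
    have h1 : u ⬝ᵥ G.lapMatrix ℝ *ᵥ b k = 0 := by
      rw [← lapMatrix_mulVec_dotProduct, hu, zero_dotProduct]
    rw [hb, dotProduct_smul, smul_eq_mul] at h1
    exact (mul_eq_zero.1 h1).resolve_left (h0.trans_le (hle k hk)).ne'
  have huj : u ⬝ᵥ b j ≠ 0 := by
    intro h
    have h1 := hp u u
    rw [Finset.sum_eq_zero] at h1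
    · simp only [u, dotProduct, mul_one, Finset.sum_const, Finset.card_univ, nsmul_eq_mul] at h1
      have : Fintype.card V = 0 := by exact_mod_cast h1
      omega
    · intro k _
      by_cases hk : k = j
      · rw [hk, h, zero_mul]
      · rw [horth k hk, zero_mul]
  have hfj : f ⬝ᵥ b j = 0 := by
    have h1 := hp f u
    have h2 : f ⬝ᵥ u = 0 := by simpa [dotProduct, u] using hf
    rw [h2, Finset.sum_eq_single j] at h1
    · exact (mul_eq_zero.1 h1.symm).resolve_right huj
    · intro k _ hk
      rw [horth k hk, mul_zero]
    · simp
  rw [hs, hp f f, Finset.mul_sum]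
  refine Finset.sum_le_sum fun k _ => ?_
  by_cases hk : k = j
  · simp [hk, hfj]
  · rw [← sq]
    exact mul_le_mul_of_nonneg_right (hle k hk) (sq_nonneg _)

/-- A Fiedler vector. -/
theorem exists_energy_le_algebraicConnectivity (hV : 2 ≤ Fintype.card V) :
    ∃ f : V → ℝ, f ≠ 0 ∧ ∑ v, f v = 0 ∧
      f ⬝ᵥ G.lapMatrix ℝ *ᵥ f ≤ algebraicConnectivity G * (f ⬝ᵥ f) := by
  rw [algebraicConnectivity, dif_pos hV]
  set hA := G.isHermitian_lapMatrix (R := ℝ)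
  set i : Fin (Fintype.card V) := ⟨Fintype.card V - 2, by omega⟩ with hi
  set j : Fin (Fintype.card V) := ⟨Fintype.card V - 1, by omega⟩ with hj
  have hij : i ≠ j := by
    intro h
    have := congrArg Fin.val h
    simp only [hi, hj] at this
    omega
  have hle : hA.eigenvalues₀ j ≤ hA.eigenvalues₀ i :=
    hA.eigenvalues₀_antitone (by rw [Fin.le_def]; simp only [hi, hj]; omega)
  obtain ⟨b, hb, ho, hp⟩ := exists_orthonormal_eigenvalues₀ hA
  -- The span of the last two eigenvectors is a plane, so it meets the hyperplane of zero-sum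
  -- functions nontrivially.
  obtain ⟨s, t, hst, hsum⟩ : ∃ s t : ℝ, s ^ 2 + t ^ 2 ≠ 0 ∧
      s * (∑ v, b i v) + t * (∑ v, b j v) = 0 := by
    by_cases h : ∑ v, b j v = 0
    · exact ⟨0, 1, by norm_num, by rw [h]; ring⟩
    · refine ⟨∑ v, b j v, -∑ v, b i v, ?_, by ring⟩
      have := sq_pos_of_ne_zero h
      positivity
  have hnorm : (s • b i + t • b j) ⬝ᵥ (s • b i + t • b j) = s ^ 2 + t ^ 2 := by
    simp only [add_dotProduct, dotProduct_add, smul_dotProduct, dotProduct_smul, ho, smul_eq_mul,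
      if_neg hij, if_neg hij.symm, if_true]
    ring
  refine ⟨s • b i + t • b j, ?_, ?_, ?_⟩
  · intro h
    rw [h, zero_dotProduct] at hnorm
    exact hst hnorm.symm
  · simpa [Finset.sum_add_distrib, ← Finset.mul_sum] using hsum
  · rw [hnorm, mulVec_add, mulVec_smul, mulVec_smul, hb, hb]
    simp only [add_dotProduct, dotProduct_add, smul_dotProduct, dotProduct_smul, ho, smul_eq_mul,
      if_neg hij, if_neg hij.symm, if_true]
    nlinarith [mul_le_mul_of_nonneg_left hle (sq_nonneg t)]

/-- A function with zero sum attaining the variational bound is an eigenvector. -/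
theorem lapMatrix_mulVec_eq_of_energy_le (hV : 2 ≤ Fintype.card V) (f : V → ℝ)
    (hf : ∑ v, f v = 0)
    (hE : f ⬝ᵥ G.lapMatrix ℝ *ᵥ f ≤ algebraicConnectivity G * (f ⬝ᵥ f)) :
    G.lapMatrix ℝ *ᵥ f = algebraicConnectivity G • f := by
  set lam := algebraicConnectivity G with hlam
  have key : ∀ w : V → ℝ, ∑ v, w v = 0 → w ⬝ᵥ G.lapMatrix ℝ *ᵥ f = lam * (w ⬝ᵥ f) := by
    intro w hw
    set p := w ⬝ᵥ G.lapMatrix ℝ *ᵥ f - lam * (w ⬝ᵥ f) with hp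
    set q := w ⬝ᵥ G.lapMatrix ℝ *ᵥ w - lam * (w ⬝ᵥ w) with hq
    -- Minimality of `f` under the perturbation `f + t • w`; the linear coefficient `p` must then
    -- vanish.
    have hquad : ∀ t : ℝ, 0 ≤ 2 * t * p + t ^ 2 * q := by
      intro t
      have h := G.algebraicConnectivity_mul_le hV (f + t • w)
        (by simp [Finset.sum_add_distrib, ← Finset.mul_sum, hf, hw])
      have hsymm : f ⬝ᵥ G.lapMatrix ℝ *ᵥ w = w ⬝ᵥ G.lapMatrix ℝ *ᵥ f := by
        rw [← lapMatrix_mulVec_dotProduct, dotProduct_comm]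
      simp only [mulVec_add, mulVec_smul, add_dotProduct, dotProduct_add, smul_dotProduct,
        dotProduct_smul, smul_eq_mul, ← hlam, hsymm, dotProduct_comm f w] at h
      rw [hp, hq]
      nlinarith
    have hp0 : p = 0 := by
      by_contra hne
      have hq0 : 0 < |q| + 1 := by positivity
      -- The minimizer `-p / q` with a denominator that stays positive whatever the sign of `q`.
      have h := hquad (-p / (|q| + 1))
      have h1 : 2 * (-p / (|q| + 1)) * p + (-p / (|q| + 1)) ^ 2 * q
          = p ^ 2 * (q - 2 * (|q| + 1)) / (|q| + 1) ^ 2 := by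
        field_simp
        ring
      rw [h1] at h
      have h2 : p ^ 2 * (q - 2 * (|q| + 1)) < 0 :=
        mul_neg_of_pos_of_neg (sq_pos_of_ne_zero hne) (by linarith [le_abs_self q, abs_nonneg q])
      exact absurd h (not_le.2 (div_neg_of_neg_of_pos h2 (by positivity)))
    linarith
  have hcard : (Fintype.card V : ℝ) ≠ 0 := by
    have : Fintype.card V ≠ 0 := by omega
    exact_mod_cast this
  ext v
  set u : V → ℝ := fun _ => 1
  have hu : G.lapMatrix ℝ *ᵥ u = 0 := G.lapMatrix_mulVec_const_eq_zero
  -- The projection of the point mass at `v` onto zero-sum functions.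
  have h := key (Pi.single v 1 - (1 / (Fintype.card V : ℝ)) • u)
    (by simp [u, Finset.sum_sub_distrib, hcard])
  have h1 : u ⬝ᵥ G.lapMatrix ℝ *ᵥ f = 0 := by
    rw [← lapMatrix_mulVec_dotProduct, hu, zero_dotProduct]
  have h2 : u ⬝ᵥ f = 0 := by simpa [dotProduct, u] using hf
  simpa [sub_dotProduct, smul_dotProduct, h1, h2] using h

variable {G}

theorem Iso.lapMatrix_energy {W : Type*} [Fintype W] [DecidableEq W] {H : SimpleGraph W}
    [DecidableRel H.Adj] (e : G ≃g H) (f : W → ℝ) :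
    (f ∘ e) ⬝ᵥ G.lapMatrix ℝ *ᵥ (f ∘ e) = f ⬝ᵥ H.lapMatrix ℝ *ᵥ f := by
  rw [← toLinearMap₂'_apply', ← toLinearMap₂'_apply', lapMatrix_toLinearMap₂',
    lapMatrix_toLinearMap₂']
  congr 1
  rw [← e.toEquiv.sum_comp]
  refine Finset.sum_congr rfl fun v _ => ?_
  rw [← e.toEquiv.sum_comp]
  refine Finset.sum_congr rfl fun w _ => ?_
  exact if_congr e.map_adj_iff.symm rfl rfl

theorem Iso.algebraicConnectivity_le {W : Type*} [Fintype W] [DecidableEq W] {H : SimpleGraph W}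
    [DecidableRel H.Adj] (e : G ≃g H) (hV : 2 ≤ Fintype.card V) :
    algebraicConnectivity G ≤ algebraicConnectivity H := by
  obtain ⟨f, hf0, hf, hE⟩ := H.exists_energy_le_algebraicConnectivity
    (by rwa [← Fintype.card_congr e.toEquiv])
  have h := G.algebraicConnectivity_mul_le hV (f ∘ e) (by
    rw [← hf]; exact e.toEquiv.sum_comp f)
  rw [e.lapMatrix_energy] at h
  have hn : (f ∘ e) ⬝ᵥ (f ∘ e) = f ⬝ᵥ f := e.toEquiv.sum_comp (fun w => f w * f w)
  rw [hn] at h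
  have hpos : 0 < f ⬝ᵥ f := by simpa using dotProduct_star_self_pos_iff.2 hf0
  exact le_of_mul_le_mul_right (h.trans hE) hpos

theorem Iso.algebraicConnectivity_eq {W : Type*} [Fintype W] [DecidableEq W] {H : SimpleGraph W}
    [DecidableRel H.Adj] (e : G ≃g H) (hV : 2 ≤ Fintype.card V) :
    algebraicConnectivity G = algebraicConnectivity H :=
  le_antisymm (e.algebraicConnectivity_le hV)
    (e.symm.algebraicConnectivity_le (by rwa [← Fintype.card_congr e.toEquiv]))

end SimpleGraph

/-! ### Summation by parts. -/

open Finset in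
/-- Summation by parts against a weight of total mass zero. -/
theorem sum_range_succ_mul_of_sum_eq_zero (m : ℕ) (x a : ℕ → ℝ)
    (ha : ∑ i ∈ range (m + 1), a i = 0) :
    ∑ i ∈ range (m + 1), x i * a i =
      -∑ k ∈ range m, (x (k + 1) - x k) * ∑ i ∈ range (k + 1), a i := by
  have h := Finset.sum_range_by_parts x a (m + 1)
  simp only [smul_eq_mul, ha, mul_zero, zero_sub, Nat.add_sub_cancel] at h
  exact h

open Finset in
/-- Summation by parts in both indices of an array with zero row and column sums. -/
theorem sum_sum_mul_of_marginals_eq_zero (m : ℕ) (x y : ℕ → ℝ) (D : ℕ → ℕ → ℝ)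
    (hrow : ∀ i < m + 1, ∑ j ∈ range (m + 1), D i j = 0)
    (hcol : ∀ j < m + 1, ∑ i ∈ range (m + 1), D i j = 0) :
    ∑ i ∈ range (m + 1), ∑ j ∈ range (m + 1), x i * y j * D i j =
      ∑ k ∈ range m, ∑ l ∈ range m, (x (k + 1) - x k) * (y (l + 1) - y l) *
        ∑ i ∈ range (k + 1), ∑ j ∈ range (l + 1), D i j := by
  have h1 : ∀ i ∈ range (m + 1), ∑ j ∈ range (m + 1), x i * y j * D i j =
      x i * -∑ l ∈ range m, (y (l + 1) - y l) * ∑ j ∈ range (l + 1), D i j := by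
    intro i hi
    rw [← sum_range_succ_mul_of_sum_eq_zero m y (D i) (hrow i (mem_range.1 hi)), mul_sum]
    exact sum_congr rfl fun j _ => by ring
  rw [sum_congr rfl h1, sum_range_succ_mul_of_sum_eq_zero, ← sum_neg_distrib]
  · refine sum_congr rfl fun k _ => ?_
    rw [sum_neg_distrib, sum_comm, mul_neg, neg_neg, mul_sum]
    refine sum_congr rfl fun l _ => ?_
    rw [← mul_sum, mul_assoc]
  · rw [sum_neg_distrib, sum_comm, neg_eq_zero]
    refine sum_eq_zero fun l hl => ?_
    rw [← mul_sum, sum_comm, sum_eq_zero, mul_zero]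
    intro j hj
    exact hcol j (by simp only [mem_range] at hl hj; omega)

/-! ### Edge counts in initial boxes. -/

/-- The `0`-`1` array of a relation. -/
def relInd (R : ℕ → ℕ → Prop) [DecidableRel R] (i j : ℕ) : ℝ := if R i j then 1 else 0

open Finset in
/-- The number of related pairs `(i, j)` with `i < k` and `j < l`. -/
noncomputable def relBlock (R : ℕ → ℕ → Prop) [DecidableRel R] (k l : ℕ) : ℝ :=
  ∑ i ∈ range k, ∑ j ∈ range l, relInd R i j

/-- The biadjacency relation of a cubic bipartite graph on `n + n` vertices in which no proper
initial segment of the two parts is a union of components. -/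
structure CubicLink (n : ℕ) (R : ℕ → ℕ → Prop) [DecidableRel R] : Prop where
  row : ∀ i < n, ((Finset.range n).filter (fun j => R i j)).card = 3
  col : ∀ j < n, ((Finset.range n).filter (fun i => R i j)).card = 3
  cross : ∀ k, 0 < k → k < n → ∃ i < n, ∃ j < n, R i j ∧ (i < k ↔ k ≤ j)

section relInd

variable (R : ℕ → ℕ → Prop) [DecidableRel R]

open Finset

theorem relInd_nonneg (i j : ℕ) : 0 ≤ relInd R i j := by
  unfold relInd; split_ifs <;> norm_num

theorem relInd_le_one (i j : ℕ) : relInd R i j ≤ 1 := by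
  unfold relInd; split_ifs <;> norm_num

theorem relBlock_swap (k l : ℕ) : relBlock (Function.swap R) k l = relBlock R l k := by
  unfold relBlock
  rw [sum_comm]
  rfl

theorem sum_relInd_le (s t : Finset ℕ) :
    ∑ i ∈ s, ∑ j ∈ t, relInd R i j ≤ s.card * t.card := by
  calc ∑ i ∈ s, ∑ j ∈ t, relInd R i j ≤ ∑ i ∈ s, ∑ j ∈ t, (1 : ℝ) :=
        sum_le_sum fun i _ => sum_le_sum fun j _ => relInd_le_one R i j
    _ = _ := by simp

/-- A relation has at most as many pairs in a box as a set containing them. -/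
theorem sum_relInd_le_card (s t : Finset ℕ) (S : Finset (ℕ × ℕ))
    (h : ∀ i ∈ s, ∀ j ∈ t, R i j → (i, j) ∈ S) :
    ∑ i ∈ s, ∑ j ∈ t, relInd R i j ≤ S.card := by
  rw [← sum_product']
  simp only [relInd, sum_boole]
  norm_cast
  refine card_le_card fun p hp => ?_
  simp only [mem_filter, mem_product] at hp
  exact h _ hp.1.1 _ hp.1.2 hp.2

theorem relInd_eq_relBlock (i j : ℕ) : relInd R i j =
    relBlock R (i + 1) (j + 1) - relBlock R i (j + 1) - relBlock R (i + 1) j + relBlock R i j := by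
  simp only [relBlock, sum_range_succ, sum_add_distrib]
  ring

end relInd

namespace CubicLink

variable {n : ℕ} {R : ℕ → ℕ → Prop} [DecidableRel R]

open Finset

theorem swap (h : CubicLink n R) : CubicLink n (Function.swap R) where
  row := h.col
  col := h.row
  cross k h0 h1 := by
    obtain ⟨i, hi, j, hj, hR, hij⟩ := h.cross k h0 h1
    exact ⟨j, hj, i, hi, hR, by omega⟩

theorem sum_row (h : CubicLink n R) {i : ℕ} (hi : i < n) :
    ∑ j ∈ range n, relInd R i j = 3 := by
  simp only [relInd, sum_boole, h.row i hi]
  norm_num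

theorem sum_col (h : CubicLink n R) {j : ℕ} (hj : j < n) :
    ∑ i ∈ range n, relInd R i j = 3 := by
  simp only [relInd, sum_boole, h.col j hj]
  norm_num

theorem relBlock_add (h : CubicLink n R) {k l : ℕ} (hk : k ≤ n) (hl : l ≤ n) :
    relBlock R k l + ∑ i ∈ range k, ∑ j ∈ Ico l n, relInd R i j = 3 * k := by
  rw [relBlock, ← sum_add_distrib]
  simp only [sum_range_add_sum_Ico _ hl]
  rw [sum_congr rfl fun i hi => h.sum_row ((mem_range.1 hi).trans_le hk)]
  simp [mul_comm]

/-- Inclusion-exclusion with all row and column sums equal to 3. It transfers bounds from the upper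
end to the lower one. -/
theorem relBlock_compl (h : CubicLink n R) {k l : ℕ} (hk : k ≤ n) (hl : l ≤ n) :
    ∑ i ∈ Ico k n, ∑ j ∈ Ico l n, relInd R i j = 3 * n - 3 * k - 3 * l + relBlock R k l := by
  have h1 := h.relBlock_add hk hl
  have h2 : ∑ i ∈ range n, ∑ j ∈ Ico l n, relInd R i j = 3 * (n - l) := by
    rw [sum_comm, sum_congr rfl fun j hj => h.sum_col (mem_Ico.1 hj).2]
    simp [mul_comm, Nat.cast_sub hl]
  have h3 := sum_range_add_sum_Ico (fun i => ∑ j ∈ Ico l n, relInd R i j) hk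
  linarith

theorem relBlock_le_three_mul (h : CubicLink n R) {k l : ℕ} (hk : k ≤ n) (hl : l ≤ n) :
    relBlock R k l ≤ 3 * k := by
  have h1 := h.relBlock_add hk hl
  have h2 : 0 ≤ ∑ i ∈ range k, ∑ j ∈ Ico l n, relInd R i j :=
    sum_nonneg fun i _ => sum_nonneg fun j _ => relInd_nonneg R i j
  linarith

theorem relBlock_le_mul (k l : ℕ) : relBlock R k l ≤ k * l := by
  simpa [relBlock] using sum_relInd_le R (range k) (range l)

theorem relBlock_le_compl (h : CubicLink n R) {k l : ℕ} (hk : k ≤ n) (hl : l ≤ n) :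
    relBlock R k l ≤ 3 * k + 3 * l - 3 * n + (n - k) * (n - l) := by
  have h1 := h.relBlock_compl hk hl
  have h2 := sum_relInd_le R (Ico k n) (Ico l n)
  simp only [Nat.card_Ico, Nat.cast_sub hk, Nat.cast_sub hl] at h2
  linarith

theorem relBlock_diag_le (h : CubicLink n R) {k : ℕ} (h0 : 0 < k) (hk : k < n) :
    relBlock R k k ≤ 3 * k - 1 := by
  have aux : ∀ {Q : ℕ → ℕ → Prop} [DecidableRel Q], CubicLink n Q →
      ∀ i j, i < k → k ≤ j → j < n → Q i j → relBlock Q k k ≤ 3 * k - 1 := by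
    intro Q _ hQ i j hi hkj hj hij
    have h1 := hQ.relBlock_add hk.le hk.le
    have h2 : (1 : ℝ) ≤ ∑ i ∈ range k, ∑ j ∈ Ico k n, relInd Q i j := by
      calc (1 : ℝ) = relInd Q i j := by simp [relInd, hij]
        _ ≤ ∑ j ∈ Ico k n, relInd Q i j :=
          single_le_sum (f := fun j => relInd Q i j) (fun j _ => relInd_nonneg Q i j)
            (mem_Ico.2 ⟨hkj, hj⟩)
        _ ≤ _ := single_le_sum (f := fun i => ∑ j ∈ Ico k n, relInd Q i j)
          (fun i _ => sum_nonneg fun j _ => relInd_nonneg Q i j) (mem_range.2 hi)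
    linarith
  -- The crossing edge may leave the box through a row or through a column; the diagonal count is
  -- symmetric, so `swap` reduces the second case to the first.
  obtain ⟨i, hi, j, hj, hR, hij⟩ := h.cross k h0 hk
  by_cases hik : i < k
  · exact aux h i j hik (hij.1 hik) hj hR
  · rw [← relBlock_swap]
    exact aux h.swap j i (by omega) (by omega) hi hR

end CubicLink

/-! ### Extremality and rigidity of the path-like relation. -/

/-- The relation `u_i ∼ v_j` of `HGraph n`, with indices starting at `0`. -/
def pathLink (n i j : ℕ) : Prop := HLink n (i + 1) (j + 1)

instance (n : ℕ) : DecidableRel (pathLink n) :=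
  fun i j => inferInstanceAs (Decidable (HLink n (i + 1) (j + 1)))

theorem pathLink_comm {n i j : ℕ} : pathLink n i j ↔ pathLink n j i := by
  unfold pathLink HLink; omega

section pathLink

open Finset

variable {n : ℕ}

theorem pathLink_row_zero_one (hn : 6 ≤ n) {i : ℕ} (hi : i ≤ 1) :
    (range n).filter (fun j => pathLink n i j) = {0, 1, 2} := by
  ext j
  rw [mem_filter]
  simp only [mem_range, mem_insert, mem_singleton, pathLink, HLink]
  omega

theorem pathLink_row_two (hn : 6 ≤ n) {i : ℕ} (hi : i = 2) :
    (range n).filter (fun j => pathLink n i j) = {0, 1, 3} := by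
  ext j
  rw [mem_filter]
  simp only [mem_range, mem_insert, mem_singleton, pathLink, HLink]
  omega

theorem pathLink_row_mid {i : ℕ} (h3 : 3 ≤ i) (hi : i + 4 ≤ n) :
    (range n).filter (fun j => pathLink n i j) = {i - 1, i, i + 1} := by
  ext j
  rw [mem_filter]
  simp only [mem_range, mem_insert, mem_singleton, pathLink, HLink]
  omega

theorem pathLink_row_sub_three (hn : 6 ≤ n) {i : ℕ} (hi : i + 3 = n) :
    (range n).filter (fun j => pathLink n i j) = {i - 1, i + 1, i + 2} := by
  ext j
  rw [mem_filter]
  simp only [mem_range, mem_insert, mem_singleton, pathLink, HLink]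
  omega

theorem pathLink_row_last (hn : 6 ≤ n) {i : ℕ} (hi : n ≤ i + 2) (hin : i < n) :
    (range n).filter (fun j => pathLink n i j) = {n - 3, n - 2, n - 1} := by
  ext j
  rw [mem_filter]
  simp only [mem_range, mem_insert, mem_singleton, pathLink, HLink]
  omega

theorem card_pathLink_row (hn : 6 ≤ n) {i : ℕ} (hi : i < n) :
    ((range n).filter (fun j => pathLink n i j)).card = 3 := by
  rcases (by omega : i ≤ 1 ∨ i = 2 ∨ (3 ≤ i ∧ i + 4 ≤ n) ∨ i + 3 = n ∨ n ≤ i + 2) with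
    h | h | h | h | h
  · rw [pathLink_row_zero_one hn h]; rfl
  · rw [pathLink_row_two hn h]; rfl
  · rw [pathLink_row_mid h.1 h.2, card_eq_three]
    exact ⟨_, _, _, by omega, by omega, by omega, rfl⟩
  · rw [pathLink_row_sub_three hn h, card_eq_three]
    exact ⟨_, _, _, by omega, by omega, by omega, rfl⟩
  · rw [pathLink_row_last hn h hi, card_eq_three]
    exact ⟨_, _, _, by omega, by omega, by omega, rfl⟩

theorem cubicLink_pathLink (hn : 6 ≤ n) : CubicLink n (pathLink n) where
  row _ hi := card_pathLink_row hn hi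
  col j hj := by
    simp only [pathLink_comm (j := j)]
    exact card_pathLink_row hn hj
  cross k h0 hk := ⟨k - 1, by omega, k, hk, by unfold pathLink HLink; omega, by omega⟩

/-- The first `k` rows carry `3 * k` edges, so the claim is that the path-like relation loses as few
of them as possible to columns `≥ l`. The matching bound for `R` is `3 * k` itself, the box area
near the lower end, the area of the complementary box near the upper end, or the crossing edge on
the middle of the diagonal. -/
theorem relBlock_le_pathLink_of_le (hn : 6 ≤ n) {R : ℕ → ℕ → Prop} [DecidableRel R]
    (hR : CubicLink n R) {k l : ℕ} (hkl : k ≤ l) (hl : l ≤ n) :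
    relBlock R k l ≤ relBlock (pathLink n) k l := by
  have hk : k ≤ n := hkl.trans hl
  have hH := (cubicLink_pathLink hn).relBlock_add hk hl
  -- `S` collects the path-like edges that leave the box through its columns.
  have hS : ∀ S : Finset (ℕ × ℕ), (∀ i < k, ∀ j < n, l ≤ j → pathLink n i j → (i, j) ∈ S) →
      relBlock R k l ≤ 3 * k - S.card → relBlock R k l ≤ relBlock (pathLink n) k l := by
    intro S hS hle
    have := sum_relInd_le_card (pathLink n) (range k) (Ico l n) S (fun i hi j hj hij =>
      hS i (mem_range.1 hi) j (mem_Ico.1 hj).2 (mem_Ico.1 hj).1 hij)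
    linarith
  have h1 := hR.relBlock_le_three_mul hk hl
  have h2 := CubicLink.relBlock_le_mul (R := R) k l
  have h3 := hR.relBlock_le_compl hk hl
  have hd : k = l → 0 < k → k < n → relBlock R k l ≤ 3 * k - 1 := by
    rintro rfl; exact hR.relBlock_diag_le
  simp only [pathLink, HLink] at hS
  rcases (by omega : k + 2 ≤ l ∨ (l = k + 1 ∧ k ≠ 1 ∧ k + 2 ≠ n) ∨ (l = k + 1 ∧ k = 1) ∨
      (l = k + 1 ∧ k + 2 = n) ∨ (l = k ∧ (k = 0 ∨ k = n)) ∨ (l = k ∧ 3 ≤ k ∧ k + 3 ≤ n) ∨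
      (l = k ∧ k = 1) ∨ (l = k ∧ k = 2) ∨ (l = k ∧ k + 2 = n) ∨ (l = k ∧ k + 1 = n)) with
    h | h | h | h | h | h | h | h | h | h
  · exact hS ∅ (by intros; omega) (by simpa using h1)
  · exact hS ∅ (by intros; omega) (by simpa using h1)
  · obtain ⟨rfl, rfl⟩ := h
    refine hS {(0, 2)} (by intros; simp only [mem_singleton, Prod.mk.injEq]; omega) ?_
    norm_num at h2 ⊢; linarith
  · obtain ⟨rfl, rfl⟩ := h
    refine hS {(k - 1, k + 1)} (by intros; simp only [mem_singleton, Prod.mk.injEq]; omega) ?_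
    push_cast at h3 ⊢; simp; linarith
  · exact hS ∅ (by intros; omega) (by simpa using h1)
  · refine hS {(k - 1, k)} (by intros; simp only [mem_singleton, Prod.mk.injEq]; omega) ?_
    simpa using hd (by omega) (by omega) (by omega)
  · obtain ⟨rfl, rfl⟩ := h
    refine hS {(0, 1), (0, 2)}
      (by intros; simp only [mem_insert, mem_singleton, Prod.mk.injEq]; omega) ?_
    norm_num at h2 ⊢; linarith
  · obtain ⟨rfl, rfl⟩ := h
    refine hS {(1, 2), (0, 2)}
      (by intros; simp only [mem_insert, mem_singleton, Prod.mk.injEq]; omega) ?_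
    norm_num at h2 ⊢; linarith
  · obtain ⟨rfl, rfl⟩ := h
    refine hS {(l - 1, l), (l - 1, l + 1)}
      (by intros; simp only [mem_insert, mem_singleton, Prod.mk.injEq]; omega) ?_
    rw [card_pair (by simp)]
    push_cast at h3 ⊢; linarith
  · obtain ⟨rfl, rfl⟩ := h
    refine hS {(l - 1, l), (l - 2, l)}
      (by intros; simp only [mem_insert, mem_singleton, Prod.mk.injEq]; omega) ?_
    rw [card_pair (by simp; omega)]
    push_cast at h3 ⊢; linarith

/-- Among all cubic links, the path-like one has the most pairs in every initial box. -/
theorem relBlock_le_pathLink (hn : 6 ≤ n) {R : ℕ → ℕ → Prop} [DecidableRel R]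
    (hR : CubicLink n R) {k l : ℕ} (hk : k ≤ n) (hl : l ≤ n) :
    relBlock R k l ≤ relBlock (pathLink n) k l := by
  rcases le_total k l with h | h
  · exact relBlock_le_pathLink_of_le hn hR h hl
  · have hs : relBlock (pathLink n) k l = relBlock (pathLink n) l k := by
      rw [← relBlock_swap]
      simp only [relBlock, relInd, Function.swap, pathLink_comm]
    rw [hs, ← relBlock_swap]
    exact relBlock_le_pathLink_of_le hn hR.swap h hk

/-- Second differences of box counts recover the middle entries. In the two corners the path-like
boxes involved are full, or full up to entries already known, so equal counts force the entries of
`R` to be 1. -/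
theorem pathLink_of_relBlock_eq (hn : 6 ≤ n) {R : ℕ → ℕ → Prop} [DecidableRel R]
    (hR : CubicLink n R)
    (h : ∀ k l, 2 ≤ k → k + 2 ≤ n → 2 ≤ l → l + 2 ≤ n →
      relBlock R k l = relBlock (pathLink n) k l) {i j : ℕ} (hi : i < n) (hj : j < n) :
    R i j ↔ pathLink n i j := by
  have hc : ∀ k l, 2 ≤ k → k + 2 ≤ n → 2 ≤ l → l + 2 ≤ n →
      ∑ i ∈ Ico k n, ∑ j ∈ Ico l n, relInd R i j =
        ∑ i ∈ Ico k n, ∑ j ∈ Ico l n, relInd (pathLink n) i j := by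
    intro k l h1 h2 h3 h4
    rw [hR.relBlock_compl (by omega) (by omega),
      (cubicLink_pathLink hn).relBlock_compl (by omega) (by omega), h k l h1 h2 h3 h4]
  have hone : ∀ i j, pathLink n i j → relInd (pathLink n) i j = 1 := fun i j hij => by
    simp [relInd, hij]
  have hle := relInd_le_one R
  have hR1 : ∀ i j, 1 ≤ relInd R i j → R i j := fun i j h1 => by
    by_contra hij
    simp only [relInd, hij, if_false] at h1
    norm_num at h1
  have hsub : ∀ i < n, ∀ j < n, pathLink n i j → R i j := by
    intro i hi j hj hij
    apply hR1
    obtain ⟨m, rfl⟩ := Nat.exists_eq_add_of_le' hn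
    rcases (by unfold pathLink HLink at hij; omega :
      (2 ≤ i ∧ i ≤ m + 3 ∧ 2 ≤ j ∧ j ≤ m + 3) ∨ (i ≤ 2 ∧ j ≤ 2) ∨ (m + 3 ≤ i ∧ m + 3 ≤ j))
      with hm | hm | hm
    · have e1 := relInd_eq_relBlock R i j
      have e2 := relInd_eq_relBlock (pathLink (m + 6)) i j
      rw [h, h, h, h, ← e2, hone i j hij] at e1
      · exact e1.ge
      all_goals omega
    · have e1 := h 2 2 (by omega) (by omega) (by omega) (by omega)
      have e2 := h 2 3 (by omega) (by omega) (by omega) (by omega)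
      have e3 := h 3 2 (by omega) (by omega) (by omega) (by omega)
      simp only [relBlock, sum_range_succ, sum_range_zero, zero_add] at e1 e2 e3
      have p1 := hone 0 0 (by unfold pathLink HLink; omega)
      have p2 := hone 0 1 (by unfold pathLink HLink; omega)
      have p3 := hone 1 0 (by unfold pathLink HLink; omega)
      have p4 := hone 1 1 (by unfold pathLink HLink; omega)
      have p5 := hone 0 2 (by unfold pathLink HLink; omega)
      have p6 := hone 1 2 (by unfold pathLink HLink; omega)
      have p7 := hone 2 0 (by unfold pathLink HLink; omega)
      have p8 := hone 2 1 (by unfold pathLink HLink; omega)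
      have q1 := hle 0 0
      have q2 := hle 0 1
      have q3 := hle 1 0
      have q4 := hle 1 1
      have q5 := hle 0 2
      have q6 := hle 1 2
      have q7 := hle 2 0
      have q8 := hle 2 1
      rcases (by unfold pathLink HLink at hij; omega : (i = 0 ∧ j = 0) ∨ (i = 0 ∧ j = 1) ∨
        (i = 1 ∧ j = 0) ∨ (i = 1 ∧ j = 1) ∨ (i = 0 ∧ j = 2) ∨ (i = 1 ∧ j = 2) ∨
        (i = 2 ∧ j = 0) ∨ (i = 2 ∧ j = 1)) with
        ⟨rfl, rfl⟩ | ⟨rfl, rfl⟩ | ⟨rfl, rfl⟩ | ⟨rfl, rfl⟩ | ⟨rfl, rfl⟩ | ⟨rfl, rfl⟩ |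
        ⟨rfl, rfl⟩ | ⟨rfl, rfl⟩ <;> linarith
    · have e1 := hc (m + 4) (m + 4) (by omega) (by omega) (by omega) (by omega)
      have e2 := hc (m + 4) (m + 3) (by omega) (by omega) (by omega) (by omega)
      have e3 := hc (m + 3) (m + 4) (by omega) (by omega) (by omega) (by omega)
      have r4 : Ico (m + 4) (m + 6) = {m + 4, m + 5} := by ext; simp; omega
      have r3 : Ico (m + 3) (m + 6) = {m + 3, m + 4, m + 5} := by ext; simp; omega
      simp only [r3, r4, sum_insert, mem_insert, mem_singleton, sum_singleton,
        Nat.add_left_cancel_iff, Nat.reduceEqDiff, or_self, not_false_eq_true] at e1 e2 e3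
      have p1 := hone (m + 5) (m + 5) (by unfold pathLink HLink; omega)
      have p2 := hone (m + 5) (m + 4) (by unfold pathLink HLink; omega)
      have p3 := hone (m + 4) (m + 5) (by unfold pathLink HLink; omega)
      have p4 := hone (m + 4) (m + 4) (by unfold pathLink HLink; omega)
      have p5 := hone (m + 5) (m + 3) (by unfold pathLink HLink; omega)
      have p6 := hone (m + 4) (m + 3) (by unfold pathLink HLink; omega)
      have p7 := hone (m + 3) (m + 5) (by unfold pathLink HLink; omega)
      have p8 := hone (m + 3) (m + 4) (by unfold pathLink HLink; omega)
      have q1 := hle (m + 5) (m + 5)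
      have q2 := hle (m + 5) (m + 4)
      have q3 := hle (m + 4) (m + 5)
      have q4 := hle (m + 4) (m + 4)
      have q5 := hle (m + 5) (m + 3)
      have q6 := hle (m + 4) (m + 3)
      have q7 := hle (m + 3) (m + 5)
      have q8 := hle (m + 3) (m + 4)
      rcases (by unfold pathLink HLink at hij; omega : (i = m + 5 ∧ j = m + 5) ∨
        (i = m + 5 ∧ j = m + 4) ∨ (i = m + 4 ∧ j = m + 5) ∨ (i = m + 4 ∧ j = m + 4) ∨
        (i = m + 5 ∧ j = m + 3) ∨ (i = m + 4 ∧ j = m + 3) ∨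
        (i = m + 3 ∧ j = m + 5) ∨ (i = m + 3 ∧ j = m + 4)) with
        ⟨rfl, rfl⟩ | ⟨rfl, rfl⟩ | ⟨rfl, rfl⟩ | ⟨rfl, rfl⟩ | ⟨rfl, rfl⟩ | ⟨rfl, rfl⟩ |
        ⟨rfl, rfl⟩ | ⟨rfl, rfl⟩ <;> linarith
  -- Both rows have three elements, so the inclusion is an equality.
  have hfil : (range n).filter (fun j => pathLink n i j) = (range n).filter (fun j => R i j) := by
    refine eq_of_subset_of_card_le (fun j hj => ?_) ?_
    · rw [mem_filter, mem_range] at hj ⊢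
      exact ⟨hj.1, hsub i hi j hj.1 hj.2⟩
    · rw [hR.row i hi, card_pathLink_row hn hi]
  have := Finset.ext_iff.1 hfil j
  simpa [hj, eq_comm, iff_comm] using this

end pathLink

/-! ### Comparison of edge sums and strict growth of sorted eigenvectors. -/

section Comparison

open Finset

variable {n : ℕ}

theorem sum_mul_relInd_sub_eq {R : ℕ → ℕ → Prop} [DecidableRel R] (hn : 6 ≤ n)
    (hR : CubicLink n R) (x y : ℕ → ℝ) :
    ∑ i ∈ range n, ∑ j ∈ range n, x i * y j * relInd (pathLink n) i j -
      ∑ i ∈ range n, ∑ j ∈ range n, x i * y j * relInd R i j =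
    ∑ k ∈ range (n - 1), ∑ l ∈ range (n - 1), (x (k + 1) - x k) * (y (l + 1) - y l) *
      (relBlock (pathLink n) (k + 1) (l + 1) - relBlock R (k + 1) (l + 1)) := by
  have hH := cubicLink_pathLink hn
  obtain ⟨m, rfl⟩ : ∃ m, n = m + 1 := ⟨n - 1, by omega⟩
  have h := sum_sum_mul_of_marginals_eq_zero m x y
    (fun i j => relInd (pathLink (m + 1)) i j - relInd R i j)
    (fun i hi => by rw [sum_sub_distrib, hH.sum_row hi, hR.sum_row hi, sub_self])
    (fun j hj => by rw [sum_sub_distrib, hH.sum_col hj, hR.sum_col hj, sub_self])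
  simp only [mul_sub, sum_sub_distrib, Nat.add_sub_cancel, relBlock] at h ⊢
  exact h

theorem sum_mul_relInd_le {R : ℕ → ℕ → Prop} [DecidableRel R] (hn : 6 ≤ n)
    (hR : CubicLink n R) {x y : ℕ → ℝ} (hx : ∀ i j, i ≤ j → j < n → x i ≤ x j)
    (hy : ∀ i j, i ≤ j → j < n → y i ≤ y j) :
    ∑ i ∈ range n, ∑ j ∈ range n, x i * y j * relInd R i j ≤
      ∑ i ∈ range n, ∑ j ∈ range n, x i * y j * relInd (pathLink n) i j := by
  rw [← sub_nonneg, sum_mul_relInd_sub_eq hn hR]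
  refine sum_nonneg fun k hk => sum_nonneg fun l hl => ?_
  rw [mem_range] at hk hl
  have h1 := hx k (k + 1) (by omega) (by omega)
  have h2 := hy l (l + 1) (by omega) (by omega)
  have h3 := relBlock_le_pathLink hn hR (k := k + 1) (l := l + 1) (by omega) (by omega)
  exact mul_nonneg (mul_nonneg (sub_nonneg.2 h1) (sub_nonneg.2 h2)) (sub_nonneg.2 h3)

theorem relBlock_eq_of_sum_mul_relInd_le {R : ℕ → ℕ → Prop} [DecidableRel R] (hn : 6 ≤ n)
    (hR : CubicLink n R) {x y : ℕ → ℝ} (hx : ∀ i j, i ≤ j → j < n → x i ≤ x j)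
    (hy : ∀ i j, i ≤ j → j < n → y i ≤ y j)
    (h : ∑ i ∈ range n, ∑ j ∈ range n, x i * y j * relInd (pathLink n) i j ≤
      ∑ i ∈ range n, ∑ j ∈ range n, x i * y j * relInd R i j)
    {k l : ℕ} (hk : k + 1 < n) (hl : l + 1 < n) (hxk : x k < x (k + 1)) (hyl : y l < y (l + 1)) :
    relBlock R (k + 1) (l + 1) = relBlock (pathLink n) (k + 1) (l + 1) := by
  have hnn : ∀ k ∈ range (n - 1), ∀ l ∈ range (n - 1),
      0 ≤ (x (k + 1) - x k) * (y (l + 1) - y l) *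
        (relBlock (pathLink n) (k + 1) (l + 1) - relBlock R (k + 1) (l + 1)) := by
    intro k hk l hl
    rw [mem_range] at hk hl
    have h1 := hx k (k + 1) (by omega) (by omega)
    have h2 := hy l (l + 1) (by omega) (by omega)
    have h3 := relBlock_le_pathLink hn hR (k := k + 1) (l := l + 1) (by omega) (by omega)
    exact mul_nonneg (mul_nonneg (sub_nonneg.2 h1) (sub_nonneg.2 h2)) (sub_nonneg.2 h3)
  have hzero := le_antisymm (sub_nonpos.2 h) (sub_nonneg.2 (sum_mul_relInd_le hn hR hx hy))
  rw [sum_mul_relInd_sub_eq hn hR,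
    sum_eq_zero_iff_of_nonneg fun k hk => sum_nonneg (hnn k hk)] at hzero
  have h1 := hzero k (mem_range.2 (by omega))
  rw [sum_eq_zero_iff_of_nonneg (hnn k (mem_range.2 (by omega)))] at h1
  have h2 := h1 l (mem_range.2 (by omega))
  have h3 := (mul_eq_zero.1 h2).resolve_left
    (mul_pos (sub_pos.2 hxk) (sub_pos.2 hyl)).ne'
  linarith

/-- The initial sums of a nonconstant increasing sequence of total sum zero are negative. -/
theorem sum_range_neg_of_monotone {z : ℕ → ℝ} (hz : ∀ i j, i ≤ j → j < n → z i ≤ z j)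
    (hsum : ∑ i ∈ range n, z i = 0) (hlt : z 0 < z (n - 1)) {k : ℕ} (h0 : 0 < k) (hk : k < n) :
    ∑ i ∈ range k, z i < 0 := by
  have h1 : z (k - 1) - z 0 ≤ ∑ i ∈ range k, (z (k - 1) - z i) :=
    single_le_sum (f := fun i => z (k - 1) - z i)
      (fun i hi => sub_nonneg.2 (hz _ _ (by rw [mem_range] at hi; omega) (by omega)))
      (mem_range.2 h0)
  have h2 : z (n - 1) - z (k - 1) ≤ ∑ i ∈ Ico k n, (z i - z (k - 1)) :=
    single_le_sum (f := fun i => z i - z (k - 1))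
      (fun i hi => sub_nonneg.2
        (hz _ _ (by rw [mem_Ico] at hi; omega) (by rw [mem_Ico] at hi; omega)))
      (mem_Ico.2 ⟨by omega, by omega⟩)
  have h3 := sum_range_add_sum_Ico z hk.le
  simp only [sum_sub_distrib, sum_const, card_range, Nat.card_Ico, nsmul_eq_mul,
    Nat.cast_sub hk.le] at h1 h2
  have hk0 : (0 : ℝ) < k := by exact_mod_cast h0
  have hkn : (0 : ℝ) < n - k := sub_pos.2 (by exact_mod_cast hk)
  have h4 := hz 0 (k - 1) (by omega) (by omega)
  have h5 := hz (k - 1) (n - 1) (by omega) (by omega)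
  -- With a nonnegative initial sum, `h1` forces `z (k - 1) ≥ 0` and `h2` forces `z (k - 1) ≤ 0`; at
  -- zero they give `z (n - 1) ≤ 0 ≤ z 0`.
  by_contra! hP
  have hc1 : 0 ≤ z (k - 1) := by
    by_contra! hc
    nlinarith
  have hc2 : z (k - 1) ≤ 0 := by
    by_contra! hc
    nlinarith
  have hc : z (k - 1) = 0 := le_antisymm hc2 hc1
  rw [hc] at h1 h2 h4 h5
  linarith

/-- An increasing pair of sequences of total sum zero that is an eigenvector of the Laplacian of
`HGraph n`. -/
structure IsSortedPathEigenpair (n : ℕ) (lam : ℝ) (x y : ℕ → ℝ) : Prop where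
  mono_left : ∀ i j, i ≤ j → j < n → x i ≤ x j
  mono_right : ∀ i j, i ≤ j → j < n → y i ≤ y j
  sum_eq_zero : ∑ i ∈ range n, x i + ∑ i ∈ range n, y i = 0
  left : ∀ i < n, ∑ j ∈ (range n).filter (fun j => pathLink n i j), y j = (3 - lam) * x i
  right : ∀ i < n, ∑ j ∈ (range n).filter (fun j => pathLink n i j), x j = (3 - lam) * y i
  exists_ne_zero : ∃ i < n, x i ≠ 0 ∨ y i ≠ 0

/-- In this range the only edges across the cut at `k` join `k - 1` to `k`, one in each direction.
-/
theorem sum_range_sum_pathLink (hn : 6 ≤ n) (y : ℕ → ℝ) {k : ℕ} (h3 : 3 ≤ k) (hk : k + 3 ≤ n) :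
    ∑ i ∈ range k, ∑ j ∈ (range n).filter (fun j => pathLink n i j), y j =
      3 * ∑ j ∈ range k, y j - y (k - 1) + y k := by
  induction k, h3 using Nat.le_induction with
  | base =>
    simp only [sum_range_succ, sum_range_zero, pathLink_row_zero_one hn (le_refl 1),
      pathLink_row_zero_one hn (zero_le_one), pathLink_row_two hn rfl]
    simp
    ring
  | succ k h3 ih =>
    rw [sum_range_succ, ih (by omega), pathLink_row_mid h3 (by omega), sum_range_succ _ k,
      sum_insert (by simp; omega), sum_insert (by simp), sum_singleton, Nat.add_sub_cancel]
    ring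

theorem pathLink_row_sum_le (hn : 6 ≤ n) {y : ℕ → ℝ} (hy : ∀ i j, i ≤ j → j < n → y i ≤ y j)
    {k : ℕ} (h3 : 3 ≤ k) (hk : k + 3 ≤ n) :
    ∑ j ∈ (range n).filter (fun j => pathLink n (k - 1) j), y j ≤ 2 * y (k - 1) + y k := by
  rcases h3.eq_or_lt with rfl | h3
  · rw [pathLink_row_two hn rfl, sum_insert (by simp), sum_insert (by simp), sum_singleton]
    have h1 := hy 0 2 (by omega) (by omega)
    have h2 := hy 1 2 (by omega) (by omega)
    norm_num
    linarith
  · rw [pathLink_row_mid (by omega) (by omega), sum_insert (by simp; omega),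
      sum_insert (by simp), sum_singleton, Nat.sub_add_cancel (by omega)]
    have h1 := hy (k - 1 - 1) (k - 1) (by omega) (by omega)
    linarith

theorem le_pathLink_row_sum (hn : 6 ≤ n) {y : ℕ → ℝ} (hy : ∀ i j, i ≤ j → j < n → y i ≤ y j)
    {k : ℕ} (h3 : 3 ≤ k) (hk : k + 3 ≤ n) :
    y (k - 1) + 2 * y k ≤ ∑ j ∈ (range n).filter (fun j => pathLink n k j), y j := by
  have h1 := hy k (k + 1) (by omega) (by omega)
  rcases hk.eq_or_lt with hk | hk
  · rw [pathLink_row_sub_three hn hk, sum_insert (by simp; omega), sum_insert (by simp),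
      sum_singleton]
    have h2 := hy k (k + 2) (by omega) (by omega)
    linarith
  · rw [pathLink_row_mid (by omega) (by omega), sum_insert (by simp; omega),
      sum_insert (by simp), sum_singleton]
    linarith

namespace IsSortedPathEigenpair

variable {lam : ℝ} {x y : ℕ → ℝ}

theorem swap (h : IsSortedPathEigenpair n lam x y) : IsSortedPathEigenpair n lam y x where
  mono_left := h.mono_right
  mono_right := h.mono_left
  sum_eq_zero := by rw [add_comm]; exact h.sum_eq_zero
  left := h.right
  right := h.left
  exists_ne_zero := by
    obtain ⟨i, hi, h⟩ := h.exists_ne_zero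
    exact ⟨i, hi, h.symm⟩

/-- Otherwise `x` and `y` are constant and opposite, which is the sign vector of the bipartition,
with eigenvalue 6. -/
theorem add_lt_add (hn : 6 ≤ n) (hlam : lam < 6) (h : IsSortedPathEigenpair n lam x y) :
    x 0 + y 0 < x (n - 1) + y (n - 1) := by
  by_contra! hle
  have h1 := h.mono_left 0 (n - 1) (by omega) (by omega)
  have h2 := h.mono_right 0 (n - 1) (by omega) (by omega)
  have hx : ∀ i < n, x i = x 0 := fun i hi => by
    have := h.mono_left 0 i (by omega) hi
    have := h.mono_left i (n - 1) (by omega) (by omega)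
    linarith
  have hy : ∀ i < n, y i = y 0 := fun i hi => by
    have := h.mono_right 0 i (by omega) hi
    have := h.mono_right i (n - 1) (by omega) (by omega)
    linarith
  have hs := h.sum_eq_zero
  rw [sum_congr rfl fun i hi => hx i (mem_range.1 hi),
    sum_congr rfl fun i hi => hy i (mem_range.1 hi)] at hs
  simp only [sum_const, card_range, nsmul_eq_mul, ← mul_add] at hs
  have hn0 : (n : ℝ) ≠ 0 := by
    have : n ≠ 0 := by omega
    exact_mod_cast this
  have hxy := (mul_eq_zero.1 hs).resolve_left hn0
  have h3 := h.left 0 (by omega)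
  rw [pathLink_row_zero_one hn (zero_le_one), sum_insert (by simp), sum_insert (by simp),
    sum_singleton, hy 1 (by omega), hy 2 (by omega)] at h3
  have h4 : (6 - lam) * x 0 = 0 := by linear_combination -h3 + 3 * hxy
  have h5 := (mul_eq_zero.1 h4).resolve_left (by linarith)
  obtain ⟨i, hi, hne⟩ := h.exists_ne_zero
  rw [hx i hi, hy i hi] at hne
  rcases hne with hne | hne
  · exact hne h5
  · exact hne (by linarith)

/-- Summing the eigenvalue equations below the cut at `k` shows that the total increment across it
is `-lam` times the sum of `x + y` below it, which is negative. -/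
theorem flow_pos (hn : 6 ≤ n) (h0 : 0 < lam) (hlam : lam < 6) (h : IsSortedPathEigenpair n lam x y)
    {k : ℕ} (h3 : 3 ≤ k) (hk : k + 3 ≤ n) :
    0 < (x k - x (k - 1)) + (y k - y (k - 1)) := by
  have hneg := sum_range_neg_of_monotone (n := n) (z := fun i => x i + y i)
    (fun i j hij hj => add_le_add (h.mono_left i j hij hj) (h.mono_right i j hij hj))
    (by rw [sum_add_distrib]; exact h.sum_eq_zero) (h.add_lt_add hn hlam) (k := k)
    (by omega) (by omega)
  have hx := sum_range_sum_pathLink hn x h3 hk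
  have hy := sum_range_sum_pathLink hn y h3 hk
  rw [sum_congr rfl fun i hi => h.right i (by rw [mem_range] at hi; omega), ← mul_sum] at hx
  rw [sum_congr rfl fun i hi => h.left i (by rw [mem_range] at hi; omega), ← mul_sum] at hy
  rw [sum_add_distrib] at hneg
  nlinarith [mul_neg_of_pos_of_neg h0 hneg]

/-- A strict step of `y` makes the neighbour sum in row `k - 1` smaller than in row `k`, which rules
out `x (k - 1) = x k`. Thus a strict step in one part passes to the other. -/
theorem lt_of_lt (hn : 6 ≤ n) (h : IsSortedPathEigenpair n lam x y)
    {k : ℕ} (h3 : 3 ≤ k) (hk : k + 3 ≤ n) (hy : y (k - 1) < y k) : x (k - 1) < x k := by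
  refine lt_of_le_of_ne (h.mono_left _ _ (by omega) (by omega)) fun heq => ?_
  have h1 := pathLink_row_sum_le hn h.mono_right h3 hk
  have h2 := le_pathLink_row_sum hn h.mono_right h3 hk
  rw [h.left _ (by omega)] at h1 h2
  rw [heq] at h1
  linarith

theorem lt_middle (hn : 6 ≤ n) (h0 : 0 < lam) (hlam : lam < 6)
    (h : IsSortedPathEigenpair n lam x y) {k : ℕ} (h3 : 3 ≤ k) (hk : k + 3 ≤ n) :
    x (k - 1) < x k := by
  by_cases hy : y (k - 1) < y k
  · exact h.lt_of_lt hn h3 hk hy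
  · have := h.flow_pos hn h0 hlam h3 hk
    linarith

/-- A sorted eigenvector is strictly increasing away from the two ends. -/
theorem lt_succ (hn : 6 ≤ n) (h0 : 0 < lam) (hlam : lam < 6)
    (h : IsSortedPathEigenpair n lam x y) {k : ℕ} (h1 : 1 ≤ k) (hk : k + 3 ≤ n) :
    x k < x (k + 1) := by
  -- In the two extreme cases rows `k` and `k + 1` differ in a single neighbour, so equal values of
  -- `x` would contradict a strict step of `y` already covered by `lt_middle`.
  rcases (by omega : k = 1 ∨ k + 3 = n ∨ (2 ≤ k ∧ k + 4 ≤ n)) with rfl | hk' | hk'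
  · refine lt_of_le_of_ne (h.mono_left _ _ (by omega) (by omega)) fun heq => ?_
    have e1 := h.left 1 (by omega)
    have e2 := h.left 2 (by omega)
    rw [pathLink_row_zero_one hn le_rfl, sum_insert (by simp), sum_insert (by simp),
      sum_singleton] at e1
    rw [pathLink_row_two hn rfl, sum_insert (by simp), sum_insert (by simp),
      sum_singleton] at e2
    have e3 := h.swap.lt_middle hn h0 hlam (k := 3) le_rfl (by omega)
    norm_num at e3 heq
    rw [heq] at e1
    linarith
  · refine lt_of_le_of_ne (h.mono_left _ _ (by omega) (by omega)) fun heq => ?_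
    have e1 := h.left k (by omega)
    have e2 := h.left (k + 1) (by omega)
    rw [pathLink_row_sub_three hn hk', sum_insert (by simp; omega), sum_insert (by simp),
      sum_singleton] at e1
    rw [pathLink_row_last hn (by omega) (by omega), sum_insert (by simp; omega),
      sum_insert (by simp; omega), sum_singleton, show n - 3 = k by omega,
      show n - 2 = k + 1 by omega, show n - 1 = k + 2 by omega] at e2
    have e3 := h.swap.lt_middle hn h0 hlam (k := k) (by omega) (by omega)
    rw [heq] at e1
    linarith
  · simpa using h.lt_middle hn h0 hlam (k := k + 1) (by omega) (by omega)

end IsSortedPathEigenpair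

end Comparison

/-! ### Bipartite graphs on two indexed parts. -/

/-- A tuple extended by zero to all natural numbers. -/
def finExt {n : ℕ} {M : Type*} [Zero M] (f : Fin n → M) (i : ℕ) : M :=
  if h : i < n then f ⟨i, h⟩ else 0

theorem finExt_val {n : ℕ} {M : Type*} [Zero M] (f : Fin n → M) (i : Fin n) :
    finExt f i = f i := by
  simp [finExt]

theorem finExt_mono {n : ℕ} {f : Fin n → ℝ} (hf : Monotone f) (i j : ℕ) (hij : i ≤ j)
    (hj : j < n) : finExt f i ≤ finExt f j := by
  simp only [finExt, hj, hij.trans_lt hj, dif_pos]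
  exact hf hij

namespace SimpleGraph

open Finset Matrix

variable {n : ℕ}

/-- The biadjacency relation of a graph on two parts of size `n`, on natural number indices. -/
def biLink (G : SimpleGraph (Fin n ⊕ Fin n)) (i j : ℕ) : Prop :=
  ∃ (hi : i < n) (hj : j < n), G.Adj (Sum.inl ⟨i, hi⟩) (Sum.inr ⟨j, hj⟩)

instance (G : SimpleGraph (Fin n ⊕ Fin n)) [DecidableRel G.Adj] : DecidableRel G.biLink :=
  fun i j => inferInstanceAs
    (Decidable (∃ (hi : i < n) (hj : j < n), G.Adj (Sum.inl ⟨i, hi⟩) (Sum.inr ⟨j, hj⟩)))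

/-- Every edge joins the left part to the right part. -/
structure IsSumBipartite (G : SimpleGraph (Fin n ⊕ Fin n)) : Prop where
  left : ∀ i j, ¬ G.Adj (Sum.inl i) (Sum.inl j)
  right : ∀ i j, ¬ G.Adj (Sum.inr i) (Sum.inr j)

theorem biLink_val {G : SimpleGraph (Fin n ⊕ Fin n)} (i j : Fin n) :
    G.biLink i j ↔ G.Adj (Sum.inl i) (Sum.inr j) := by
  simp [biLink]

variable {G : SimpleGraph (Fin n ⊕ Fin n)} [DecidableRel G.Adj]

theorem IsSumBipartite.sum_neighborFinset_inl (hG : G.IsSumBipartite) {M : Type*}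
    [AddCommMonoid M] (φ : Fin n ⊕ Fin n → M) (i : Fin n) :
    ∑ u ∈ G.neighborFinset (Sum.inl i), φ u =
      ∑ j ∈ (range n).filter (fun j => G.biLink i j), finExt (φ ∘ Sum.inr) j := by
  rw [neighborFinset_eq_filter, sum_filter, Fintype.sum_sum_type, sum_filter, sum_range]
  simp [hG.left, biLink_val, finExt_val]

theorem IsSumBipartite.sum_neighborFinset_inr (hG : G.IsSumBipartite) {M : Type*}
    [AddCommMonoid M] (φ : Fin n ⊕ Fin n → M) (j : Fin n) :
    ∑ u ∈ G.neighborFinset (Sum.inr j), φ u =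
      ∑ i ∈ (range n).filter (fun i => G.biLink i j), finExt (φ ∘ Sum.inl) i := by
  rw [neighborFinset_eq_filter, sum_filter, Fintype.sum_sum_type, sum_filter, sum_range]
  simp [hG.right, biLink_val, finExt_val, G.adj_comm (Sum.inr j)]

theorem IsSumBipartite.degree_inl (hG : G.IsSumBipartite) (i : Fin n) :
    G.degree (Sum.inl i) = ((range n).filter (fun j => G.biLink i j)).card := by
  have h := hG.sum_neighborFinset_inl (fun _ => 1) i
  rw [← card_eq_sum_ones, card_neighborFinset_eq_degree] at h
  rw [h, card_eq_sum_ones]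
  refine sum_congr rfl fun j hj => ?_
  simp [finExt, mem_range.1 (mem_filter.1 hj).1]

theorem IsSumBipartite.degree_inr (hG : G.IsSumBipartite) (j : Fin n) :
    G.degree (Sum.inr j) = ((range n).filter (fun i => G.biLink i j)).card := by
  have h := hG.sum_neighborFinset_inr (fun _ => 1) j
  rw [← card_eq_sum_ones, card_neighborFinset_eq_degree] at h
  rw [h, card_eq_sum_ones]
  refine sum_congr rfl fun j hj => ?_
  simp [finExt, mem_range.1 (mem_filter.1 hj).1]

theorem IsSumBipartite.cubicLink (hG : G.IsSumBipartite) (hreg : G.IsRegularOfDegree 3)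
    (hconn : G.Connected) : CubicLink n G.biLink where
  row i hi := by rw [← hG.degree_inl ⟨i, hi⟩, hreg]
  col j hj := by rw [← hG.degree_inr ⟨j, hj⟩, hreg]
  cross k h0 hk := by
    set S : Set (Fin n ⊕ Fin n) := {v | Sum.elim (fun i => i.val < k) (fun j => j.val < k) v}
    -- A walk from index `0` to index `k` must leave the set of vertices of index below `k`.
    obtain ⟨p⟩ := hconn.preconnected (Sum.inl ⟨0, by omega⟩) (Sum.inl ⟨k, hk⟩)
    obtain ⟨d, -, h1, h2⟩ := p.exists_boundary_dart S (by simpa [S] using h0) (by simp [S])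
    obtain ⟨⟨a, b⟩, hab⟩ := d
    rcases a with i | i <;> rcases b with j | j
    · exact absurd hab (hG.left i j)
    · refine ⟨i, i.2, j, j.2, (biLink_val i j).2 hab, ?_⟩
      simp only [S, Set.mem_ofPred_eq, Sum.elim_inl, Sum.elim_inr] at h1 h2
      omega
    · refine ⟨j, j.2, i, i.2, (biLink_val j i).2 hab.symm, ?_⟩
      simp only [S, Set.mem_ofPred_eq, Sum.elim_inl, Sum.elim_inr] at h1 h2
      omega
    · exact absurd hab (hG.right i j)

theorem IsSumBipartite.energy_eq (hG : G.IsSumBipartite) (hreg : G.IsRegularOfDegree 3)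
    (f : Fin n ⊕ Fin n → ℝ) :
    f ⬝ᵥ G.lapMatrix ℝ *ᵥ f = 3 * (f ⬝ᵥ f) - 2 * ∑ i ∈ range n, ∑ j ∈ range n,
      finExt (f ∘ Sum.inl) i * finExt (f ∘ Sum.inr) j * relInd G.biLink i j := by
  have h1 : f ⬝ᵥ G.lapMatrix ℝ *ᵥ f =
      3 * (f ⬝ᵥ f) - ∑ v, f v * ∑ u ∈ G.neighborFinset v, f u := by
    simp only [dotProduct, lapMatrix_mulVec_apply, hreg.degree_eq, mul_sub, sum_sub_distrib,
      mul_sum]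
    congr 1
    exact sum_congr rfl fun v _ => by push_cast; ring
  have h2 : ∑ i : Fin n, f (Sum.inl i) * ∑ u ∈ G.neighborFinset (Sum.inl i), f u =
      ∑ i ∈ range n, ∑ j ∈ range n,
        finExt (f ∘ Sum.inl) i * finExt (f ∘ Sum.inr) j * relInd G.biLink i j := by
    rw [sum_range]
    refine sum_congr rfl fun i _ => ?_
    rw [hG.sum_neighborFinset_inl, sum_filter, mul_sum, finExt_val]
    exact sum_congr rfl fun j _ => by simp [relInd]
  have h3 : ∑ j : Fin n, f (Sum.inr j) * ∑ u ∈ G.neighborFinset (Sum.inr j), f u =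
      ∑ i ∈ range n, ∑ j ∈ range n,
        finExt (f ∘ Sum.inl) i * finExt (f ∘ Sum.inr) j * relInd G.biLink i j := by
    rw [sum_comm, sum_range]
    refine sum_congr rfl fun j _ => ?_
    rw [hG.sum_neighborFinset_inr, sum_filter, mul_sum, finExt_val]
    exact sum_congr rfl fun i _ => by simp [relInd, mul_comm]
  rw [h1, Fintype.sum_sum_type, h2, h3]
  ring

end SimpleGraph

/-! ### The path-like graph and the comparison with it. -/

section HGraph

open Finset Matrix

variable {n : ℕ}

theorem biLink_HGraph {i j : ℕ} (hi : i < n) (hj : j < n) :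
    (HGraph n).biLink i j ↔ pathLink n i j :=
  ⟨fun ⟨_, _, h⟩ => h, fun h => ⟨hi, hj, h⟩⟩

theorem filter_biLink_HGraph {i : ℕ} (hi : i < n) :
    (range n).filter (fun j => (HGraph n).biLink i j) =
      (range n).filter (fun j => pathLink n i j) :=
  filter_congr fun _ hj => biLink_HGraph hi (mem_range.1 hj)

theorem filter_biLink_HGraph' {j : ℕ} (hj : j < n) :
    (range n).filter (fun i => (HGraph n).biLink i j) =
      (range n).filter (fun i => pathLink n j i) :=
  filter_congr fun _ hi => (biLink_HGraph (mem_range.1 hi) hj).trans pathLink_comm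

theorem isSumBipartite_HGraph (n : ℕ) : (HGraph n).IsSumBipartite :=
  ⟨fun _ _ h => h, fun _ _ h => h⟩

theorem isRegularOfDegree_HGraph (hn : 6 ≤ n) : (HGraph n).IsRegularOfDegree 3 := by
  rintro (i | j)
  · rw [(isSumBipartite_HGraph n).degree_inl, filter_biLink_HGraph i.2, card_pathLink_row hn i.2]
  · rw [(isSumBipartite_HGraph n).degree_inr, filter_biLink_HGraph' j.2, card_pathLink_row hn j.2]

theorem isBipartite_HGraph (n : ℕ) : (HGraph n).IsBipartite := by
  refine ⟨SimpleGraph.Coloring.mk (Sum.elim (fun _ => 0) (fun _ => 1)) ?_⟩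
  rintro (a | a) (b | b) h
  · exact absurd h ((isSumBipartite_HGraph n).left a b)
  · simp
  · simp
  · exact absurd h ((isSumBipartite_HGraph n).right a b)

theorem connected_HGraph (hn : 6 ≤ n) : (HGraph n).Connected := by
  have hadj : ∀ (i j : ℕ) (hi : i < n) (hj : j < n), pathLink n i j →
      (HGraph n).Reachable (Sum.inl ⟨i, hi⟩) (Sum.inr ⟨j, hj⟩) := fun i j hi hj h =>
    SimpleGraph.Adj.reachable (G := HGraph n) h
  have h0 : 0 < n := by omega
  have key : ∀ i (hi : i < n), (HGraph n).Reachable (Sum.inl ⟨0, h0⟩) (Sum.inl ⟨i, hi⟩) ∧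
      (HGraph n).Reachable (Sum.inl ⟨0, h0⟩) (Sum.inr ⟨i, hi⟩) := by
    intro i
    induction i with
    | zero => exact fun hi => ⟨.rfl, hadj _ _ _ _ (by unfold pathLink HLink; omega)⟩
    | succ i ih =>
      intro hi
      obtain ⟨h1, h2⟩ := ih (by omega)
      exact ⟨h2.trans (hadj _ _ _ _ (by unfold pathLink HLink; omega)).symm,
        h1.trans (hadj _ _ _ _ (by unfold pathLink HLink; omega))⟩
  rw [SimpleGraph.connected_iff_exists_forall_reachable]
  refine ⟨Sum.inl ⟨0, h0⟩, ?_⟩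
  rintro (i | i)
  · exact (key i i.2).1
  · exact (key i i.2).2

theorem two_le_card_sum (hn : 6 ≤ n) : 2 ≤ Fintype.card (Fin n ⊕ Fin n) := by
  rw [Fintype.card_sum, Fintype.card_fin]; omega

theorem SimpleGraph.Connected.algebraicConnectivity_pos {V : Type*} [Fintype V] [DecidableEq V]
    {G : SimpleGraph V} [DecidableRel G.Adj] (hG : G.Connected) (hV : 2 ≤ Fintype.card V) :
    0 < algebraicConnectivity G := by
  obtain ⟨f, hf0, hf, hE⟩ := G.exists_energy_le_algebraicConnectivity hV
  by_contra! hle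
  have hn : 0 ≤ f ⬝ᵥ f := by simpa using dotProduct_star_self_nonneg f
  have h0 : f ⬝ᵥ G.lapMatrix ℝ *ᵥ f = 0 :=
    le_antisymm (hE.trans (mul_nonpos_of_nonpos_of_nonneg hle hn)) (G.lapMatrix_energy_nonneg f)
  rw [← toLinearMap₂'_apply', G.lapMatrix_toLinearMap₂'_apply'_eq_zero_iff_forall_reachable] at h0
  apply hf0
  ext v
  have hv : ∀ w, f w = f v := fun w => h0 w v (hG.preconnected w v)
  simp only [hv, sum_const, card_univ, nsmul_eq_mul] at hf
  refine (mul_eq_zero.1 hf).resolve_left ?_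
  have : Fintype.card V ≠ 0 := by omega
  exact_mod_cast this

theorem algebraicConnectivity_HGraph_lt (hn : 6 ≤ n) : algebraicConnectivity (HGraph n) < 6 := by
  set i : Fin n := ⟨0, by omega⟩
  set j : Fin n := ⟨1, by omega⟩
  have hij : i ≠ j := by simp [i, j]
  -- Supported on one part, `w` has no edge term, so its Rayleigh quotient is 3.
  set w : Fin n ⊕ Fin n → ℝ := Sum.elim (Pi.single i 1 - Pi.single j 1) 0 with hw
  have hw0 : w ≠ 0 := by
    intro h
    have := congrFun h (Sum.inl i)
    simp [hw, hij] at this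
  have hpos : 0 < w ⬝ᵥ w := by simpa using dotProduct_star_self_pos_iff.2 hw0
  have h := (HGraph n).algebraicConnectivity_mul_le (two_le_card_sum hn) w
    (by simp [hw, Fintype.sum_sum_type])
  rw [(isSumBipartite_HGraph n).energy_eq (isRegularOfDegree_HGraph hn)] at h
  have hr : ∀ k, finExt (w ∘ Sum.inr) k = 0 := fun k => by simp [finExt, hw]
  simp only [hr, mul_zero, zero_mul, sum_const_zero, sub_zero] at h
  have := le_of_mul_le_mul_right h hpos
  linarith

theorem sum_relInd_HGraph (x y : ℕ → ℝ) :
    ∑ i ∈ range n, ∑ j ∈ range n, x i * y j * relInd (HGraph n).biLink i j =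
      ∑ i ∈ range n, ∑ j ∈ range n, x i * y j * relInd (pathLink n) i j := by
  refine sum_congr rfl fun i hi => sum_congr rfl fun j hj => ?_
  simp only [relInd, biLink_HGraph (mem_range.1 hi) (mem_range.1 hj)]

theorem isSortedPathEigenpair_of_mulVec_eq (hn : 6 ≤ n) {lam : ℝ} {f : Fin n ⊕ Fin n → ℝ}
    (hl : Monotone (f ∘ Sum.inl)) (hr : Monotone (f ∘ Sum.inr)) (h0 : f ≠ 0)
    (hsum : ∑ v, f v = 0) (hL : (HGraph n).lapMatrix ℝ *ᵥ f = lam • f) :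
    IsSortedPathEigenpair n lam (finExt (f ∘ Sum.inl)) (finExt (f ∘ Sum.inr)) where
  mono_left := finExt_mono hl
  mono_right := finExt_mono hr
  sum_eq_zero := by
    rw [Fintype.sum_sum_type] at hsum
    simpa [sum_range, finExt_val] using hsum
  left i hi := by
    have h := congrFun hL (Sum.inl ⟨i, hi⟩)
    rw [SimpleGraph.lapMatrix_mulVec_apply, (isRegularOfDegree_HGraph hn).degree_eq,
      (isSumBipartite_HGraph n).sum_neighborFinset_inl, filter_biLink_HGraph hi] at h
    simp only [Pi.smul_apply, smul_eq_mul] at h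
    rw [show finExt (f ∘ Sum.inl) i = f (Sum.inl ⟨i, hi⟩) from finExt_val (f ∘ Sum.inl) ⟨i, hi⟩]
    push_cast at h
    linarith
  right i hi := by
    have h := congrFun hL (Sum.inr ⟨i, hi⟩)
    rw [SimpleGraph.lapMatrix_mulVec_apply, (isRegularOfDegree_HGraph hn).degree_eq,
      (isSumBipartite_HGraph n).sum_neighborFinset_inr, filter_biLink_HGraph' hi] at h
    simp only [Pi.smul_apply, smul_eq_mul] at h
    rw [show finExt (f ∘ Sum.inr) i = f (Sum.inr ⟨i, hi⟩) from finExt_val (f ∘ Sum.inr) ⟨i, hi⟩]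
    push_cast at h
    linarith
  exists_ne_zero := by
    obtain ⟨v, hv⟩ := Function.ne_iff.1 h0
    rcases v with i | i
    · exact ⟨i, i.2, Or.inl (by simpa [finExt_val] using hv)⟩
    · exact ⟨i, i.2, Or.inr (by simpa [finExt_val] using hv)⟩

/-- The comparison for a graph whose two parts are sorted by a Fiedler vector. -/
theorem algebraicConnectivity_HGraph_le_of_sorted (hn : 6 ≤ n) {G : SimpleGraph (Fin n ⊕ Fin n)}
    [DecidableRel G.Adj] (hG : G.IsSumBipartite) (hreg : G.IsRegularOfDegree 3)
    (hconn : G.Connected) {f : Fin n ⊕ Fin n → ℝ} (hl : Monotone (f ∘ Sum.inl))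
    (hr : Monotone (f ∘ Sum.inr)) (h0 : f ≠ 0) (hsum : ∑ v, f v = 0)
    (hE : f ⬝ᵥ G.lapMatrix ℝ *ᵥ f ≤ algebraicConnectivity G * (f ⬝ᵥ f)) :
    algebraicConnectivity (HGraph n) ≤ algebraicConnectivity G ∧
      (algebraicConnectivity G = algebraicConnectivity (HGraph n) → G = HGraph n) := by
  have hR := hG.cubicLink hreg hconn
  have hcard := two_le_card_sum hn
  have hx := finExt_mono hl
  have hy := finExt_mono hr
  have hpos : 0 < f ⬝ᵥ f := by simpa using dotProduct_star_self_pos_iff.2 h0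
  have hlow := (HGraph n).algebraicConnectivity_mul_le hcard f hsum
  have hcmp := sum_mul_relInd_le hn hR hx hy
  have hEG := hG.energy_eq hreg f
  have hEH := (isSumBipartite_HGraph n).energy_eq (isRegularOfDegree_HGraph hn) f
  rw [sum_relInd_HGraph] at hEH
  refine ⟨le_of_mul_le_mul_right (by linarith) hpos, fun heq => ?_⟩
  rw [heq] at hE
  have hL := (HGraph n).lapMatrix_mulVec_eq_of_energy_le hcard f hsum (by linarith)
  have hP := isSortedPathEigenpair_of_mulVec_eq hn hl hr h0 hsum hL
  have hlam0 := (connected_HGraph hn).algebraicConnectivity_pos hcard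
  have hlam6 := algebraicConnectivity_HGraph_lt hn
  have hblock : ∀ k l, 2 ≤ k → k + 2 ≤ n → 2 ≤ l → l + 2 ≤ n →
      relBlock G.biLink k l = relBlock (pathLink n) k l := by
    intro k l hk1 hk2 hl1 hl2
    -- The box of size `k + 1` is weighted by the increment from `k` to `k + 1`, hence the shift.
    obtain ⟨k, rfl⟩ := Nat.exists_eq_add_of_le' (show 1 ≤ k by omega)
    obtain ⟨l, rfl⟩ := Nat.exists_eq_add_of_le' (show 1 ≤ l by omega)
    exact relBlock_eq_of_sum_mul_relInd_le hn hR hx hy (by linarith) (by omega) (by omega)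
      (hP.lt_succ hn hlam0 hlam6 (by omega) (by omega))
      (hP.swap.lt_succ hn hlam0 hlam6 (by omega) (by omega))
  have hlink : ∀ i j : Fin n, G.Adj (Sum.inl i) (Sum.inr j) ↔
      (HGraph n).Adj (Sum.inl i) (Sum.inr j) := fun i j =>
    (SimpleGraph.biLink_val i j).symm.trans (pathLink_of_relBlock_eq hn hR hblock i.2 j.2)
  ext (i | i) (j | j)
  · exact iff_of_false (hG.left i j) ((isSumBipartite_HGraph n).left i j)
  · exact hlink i j
  · rw [G.adj_comm, (HGraph n).adj_comm]
    exact hlink j i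
  · exact iff_of_false (hG.right i j) ((isSumBipartite_HGraph n).right i j)

end HGraph

/-! ### Sorting the two parts and conclusion. -/

open Finset in
/-- The vertices of a regular bipartite graph can be listed part by part, each part in the order of
a given function. -/
theorem SimpleGraph.IsBipartite.exists_sorted_equiv {n d : ℕ} {V : Type*} [Fintype V]
    [DecidableEq V] {G : SimpleGraph V} [DecidableRel G.Adj] (hcard : Fintype.card V = 2 * n)
    (hd : d ≠ 0) (hreg : G.IsRegularOfDegree d) (hbip : G.IsBipartite) (f : V → ℝ) :
    ∃ e : Fin n ⊕ Fin n ≃ V, (G.comap e).IsSumBipartite ∧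
      Monotone (f ∘ e ∘ Sum.inl) ∧ Monotone (f ∘ e ∘ Sum.inr) := by
  obtain ⟨c⟩ := hbip
  have hc : ∀ {v w}, G.Adj v w → c v ≠ c w := fun h => c.valid h
  have hfin : ∀ a b : Fin 2, a ≠ 0 → b ≠ 0 → a = b := by decide
  have hsum := isBipartiteWith_sum_degrees_eq (G := G) (s := univ.filter (fun v => c v = 0))
    (t := univ.filter (fun v => ¬ c v = 0))
    ⟨by rw [disjoint_coe]; exact disjoint_filter_filter_not _ _ _, fun v w h => by
      have h1 := hc h
      by_cases hv : c v = 0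
      · left; simp only [coe_filter, mem_univ, true_and, Set.mem_ofPred_eq]
        exact ⟨hv, fun hw => h1 (hv.trans hw.symm)⟩
      · right; simp only [coe_filter, mem_univ, true_and, Set.mem_ofPred_eq]
        refine ⟨hv, ?_⟩
        by_contra hw
        exact h1 (hfin _ _ hv hw)⟩
  simp only [hreg.degree_eq, sum_const, smul_eq_mul] at hsum
  -- Counting edges from either side shows that the colour classes have equal size, hence size `n`.
  have hst := Nat.eq_of_mul_eq_mul_right (Nat.pos_of_ne_zero hd) hsum
  have htot := card_filter_add_card_filter_not (s := (univ : Finset V)) (fun v => c v = 0)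
  rw [card_univ, hcard] at htot
  let a : Fin n ≃ {v // c v = 0} := Fintype.equivOfCardEq (by
    rw [Fintype.card_fin, Fintype.card_subtype]; omega)
  let b : Fin n ≃ {v // ¬ c v = 0} := Fintype.equivOfCardEq (by
    rw [Fintype.card_fin, Fintype.card_subtype]; omega)
  let a' := (Tuple.sort (fun i => f (a i))).trans a
  let b' := (Tuple.sort (fun i => f (b i))).trans b
  refine ⟨(Equiv.sumCongr a' b').trans (Equiv.sumCompl (fun v => c v = 0)), ⟨?_, ?_⟩, ?_, ?_⟩
  · intro i j h
    exact hc h ((a' i).2.trans (a' j).2.symm)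
  · intro i j h
    exact hc h (hfin _ _ (b' i).2 (b' j).2)
  · exact Tuple.monotone_sort (fun i => f (a i))
  · exact Tuple.monotone_sort (fun i => f (b i))

theorem theorem1p3 (n : ℕ) (hn : 6 ≤ n) :
    ((HGraph n).Connected ∧ (HGraph n).IsRegularOfDegree 3 ∧ (HGraph n).IsBipartite) ∧
    ∀ {V : Type*} [Fintype V] [DecidableEq V] (G : SimpleGraph V) [DecidableRel G.Adj],
      Fintype.card V = 2 * n → G.Connected → G.IsRegularOfDegree 3 → G.IsBipartite →
        algebraicConnectivity (HGraph n) ≤ algebraicConnectivity G ∧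
        (algebraicConnectivity G = algebraicConnectivity (HGraph n) ↔
          Nonempty (G ≃g HGraph n)) := by
  refine ⟨⟨connected_HGraph hn, isRegularOfDegree_HGraph hn, isBipartite_HGraph n⟩, ?_⟩
  intro V _ _ G _ hcard hconn hreg hbip
  have hV : 2 ≤ Fintype.card V := by omega
  obtain ⟨f, h0, hsum, hE⟩ := G.exists_energy_le_algebraicConnectivity hV
  obtain ⟨e, hG, hl, hr⟩ := hbip.exists_sorted_equiv hcard three_ne_zero hreg f
  let φ : G.comap e ≃g G := SimpleGraph.Iso.comap e G
  have hφ := φ.algebraicConnectivity_eq (two_le_card_sum hn)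
  have key := algebraicConnectivity_HGraph_le_of_sorted hn hG
    (fun v => by rw [← φ.degree_eq v]; exact hreg _) (φ.connected_iff.2 hconn) (f := f ∘ e)
    hl hr
    (fun h => h0 (by
      ext v
      simpa using congrFun h (e.symm v)))
    ((e.sum_comp f).trans hsum)
    (by
      have h1 := φ.lapMatrix_energy f
      have h2 : dotProduct (f ∘ e) (f ∘ e) = dotProduct f f := e.sum_comp (fun w => f w * f w)
      rw [h2, hφ]
      exact h1.trans_le hE)
  rw [hφ] at key
  refine ⟨key.1, fun h => ?_, fun ⟨ψ⟩ => ψ.algebraicConnectivity_eq hV⟩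
  have hψ := key.2 h
  exact ⟨φ.symm.trans (hψ ▸ SimpleGraph.Iso.refl)⟩
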